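/- **Setting.** For a trial participant let $W$ be baseline variables, $A\in\{0,1\}$ the study arm, $L$ a short-term outcome, $Y$ a real primary outcome with finite variance, and $C^L,C^Y\in\{0,1\}$ the indicators that $L$, respectively $Y$, has been observed at the analysis time. A data generating distribution is a law $P$ of $(W,A,L,Y,C^L,C^Y)$ such that $A$ is independent of $W$ with $P(A=1)=P(A=0)=1/2$; $(C^L,C^Y)$ is independent of $(W,A,L,Y)$; $C^L\ge C^Y$ almost surely; and $p_y:=P(C^Y=1)>0$. Put $p_l:=P(C^L=1)$. A subscript $a$ denotes conditioning on $A=a$, e.g. $E_a(Y\mid W)=E(Y\mid W,A=a)$. Define $$R^2_W=\frac{\sum_{a}\mathrm{Var}\{E_a(Y\mid W)\}}{\sum_{a}\mathrm{Var}_a(Y)},\qquad R^2_{L\mid W}=\frac{\sum_{a}\mathrm{Var}_a\{E_a(Y\mid L,W)-E_a(Y\mid W)\}}{\sum_{a}\mathrm{Var}_a(Y)},\qquad \gamma=\frac{\mathrm{Var}\{E_1(Y\mid W)-E_0(Y\mid W)\}}{\sum_{a}\mathrm{Var}_a(Y)}.$$ An estimator of $\Delta=E(Y\mid A=1)-E(Y\mid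 A=0)$ is a sequence $\widehat\Delta_n$ of measurable functions of the observed data of $n$ i.i.d. participants ($L$ is seen only if $C^L=1$, $Y$ only if $C^Y=1$). If $\sqrt n(\widehat\Delta_n-\Delta)\to N(0,\sigma^2)$ in distribution, then $\mathrm{AVar}(\widehat\Delta)=\sigma^2$. Call an asymptotically normal estimator *efficient* at $P$ if its asymptotic variance is $$\mathrm{Var}\{E_1(Y\mid W)-E_0(Y\mid W)\}+\sum_{a}\frac{2}{p_l}\mathrm{Var}_a\{E_a(Y\mid L,W)-E_a(Y\mid W)\}+\sum_{a}\frac{2}{p_y}\mathrm{Var}_a\{Y-E_a(Y\mid L,W)\}$$ (this includes every regular asymptotically linear estimator attaining this semiparametric bound). The unadjusted estimator is the difference between the two arms of the sample means of the observed values of $Y$. The asymptotic relative efficiency of an efficient estimator is $\mathrm{ARE}=\mathrm{AVar}(\text{unadjusted})/\mathrm{AVar}(\text{efficient})\in[0,\infty]$, equal to $\infty$ if the denominator is $0$ and the numerator is positive. **Theorem.** Let $0<q\le 1$. Let $P_1,P_2$ be two data generating distributions as above, with the same $p_y$ and the same $p_l$, such that $R^2_W=q$, $R^2_{L\mid W}=0$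 under $P_1$ (only the baseline variables are prognostic) and $R^2_W=0$, $R^2_{L\mid W}=q$ under $P_2$ (only the short-term outcome is prognostic). Let $\mathrm{ARE}_j$ be the ARE, under $P_j$, of any efficient estimator with respect to the unadjusted estimator, and let $\gamma$ be the treatment effect heterogeneity under $P_1$. Then: 1. the unadjusted estimator is asymptotically normal under $P_1$ and under $P_2$, and $\mathrm{ARE}_1\ge\mathrm{ARE}_2$; 2. $\mathrm{ARE}_1=\mathrm{ARE}_2$ if and only if $p_l=1$ and $\gamma=2q$; 3. the treatment effect heterogeneity is at most $2R^2_W$ under $P_1$ and under $P_2$; in particular $\gamma\le 2q$; 4. $\gamma=2q$ if and only if, under $P_1$, $E_1(Y\mid W)-E_1(Y)=-\{E_0(Y\mid W)-E_0(Y)\}$ almost surely; equivalently, under $P_1$, $Y$ is uncorrelated with every square-integrable real function of $W$. -/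

import Mathlib

open MeasureTheory ProbabilityTheory Filter Topology
open scoped NNReal ENNReal

namespace Trial

/-- Full record `(W, A, L, Y, C^L, C^Y)` of one participant: baseline variables, study arm
(`true` is treatment, `false` is control), short-term outcome, primary outcome, and the indicators
that the short-term and the primary outcome have been observed by the analysis time. -/
abbrev Participant (𝒲 ℒ : Type*) : Type _ := 𝒲 × Bool × ℒ × ℝ × Bool × Bool

section Coordinates

variable {𝒲 ℒ : Type*}

/-- Baseline variables. -/
def W (x : Participant 𝒲 ℒ) : 𝒲 := x.1

/-- Study arm. -/
def A (x : Participant 𝒲 ℒ) : Bool := x.2.1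

/-- Short-term outcome. -/
def L (x : Participant 𝒲 ℒ) : ℒ := x.2.2.1

/-- Primary outcome. -/
def Y (x : Participant 𝒲 ℒ) : ℝ := x.2.2.2.1

/-- Whether the short-term outcome is observed. -/
def CL (x : Participant 𝒲 ℒ) : Bool := x.2.2.2.2.1

/-- Whether the primary outcome is observed. -/
def CY (x : Participant 𝒲 ℒ) : Bool := x.2.2.2.2.2

/-- Two records with the same observed part: `L` counts only if `C^L = 1`, `Y` only if
`C^Y = 1`. -/
structure SameObserved (x y : Participant 𝒲 ℒ) : Prop where
  baseline : W x = W y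
  arm : A x = A y
  seenL : CL x = CL y
  seenY : CY x = CY y
  shortTerm : CL x = true → L x = L y
  primary : CY x = true → Y x = Y y

end Coordinates

section Measurability

variable {𝒲 ℒ : Type*} [MeasurableSpace 𝒲] [MeasurableSpace ℒ]

theorem measurable_A : Measurable (A : Participant 𝒲 ℒ → Bool) := by
  unfold A; fun_prop

theorem measurable_Y : Measurable (Y : Participant 𝒲 ℒ → ℝ) := by
  unfold Y; fun_prop

theorem measurable_CY : Measurable (CY : Participant 𝒲 ℒ → Bool) := by
  unfold CY; fun_prop

end Measurability

/-- The sample mean of `Y` among the participants of arm `a` whose primary outcome is observed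
(`0` if there are none). -/
noncomputable def armMean {𝒲 ℒ : Type*} (a : Bool) {n : ℕ} (o : Fin n → Participant 𝒲 ℒ) : ℝ :=
  (∑ i, if A (o i) = a ∧ CY (o i) = true then Y (o i) else 0) /
    (∑ i, if A (o i) = a ∧ CY (o i) = true then (1 : ℝ) else 0)

theorem armMean_congr {𝒲 ℒ : Type*} (a : Bool) {n : ℕ} (o o' : Fin n → Participant 𝒲 ℒ)
    (h : ∀ i, SameObserved (o i) (o' i)) : armMean a o = armMean a o' := by
  unfold armMean
  congr 1 <;> refine Finset.sum_congr rfl fun i _ => ?_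
  · rw [← (h i).arm, ← (h i).seenY]
    by_cases hc : A (o i) = a ∧ CY (o i) = true
    · rw [if_pos hc, if_pos hc, (h i).primary hc.2]
    · rw [if_neg hc, if_neg hc]
  · rw [(h i).arm, (h i).seenY]

/-- An estimator: for each sample size, a measurable real function of the observed data. -/
structure Estimator (𝒲 ℒ : Type*) [MeasurableSpace 𝒲] [MeasurableSpace ℒ] where
  /-- The value on a sample of size `n`. -/
  val : (n : ℕ) → (Fin n → Participant 𝒲 ℒ) → ℝ
  measurable_val : ∀ n, Measurable (val n)
  observed_only : ∀ n (o o' : Fin n → Participant 𝒲 ℒ),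
    (∀ i, SameObserved (o i) (o' i)) → val n o = val n o'

section Unadjusted

variable {𝒲 ℒ : Type*} [MeasurableSpace 𝒲] [MeasurableSpace ℒ]

theorem measurable_armMean (a : Bool) (n : ℕ) :
    Measurable (armMean a : (Fin n → Participant 𝒲 ℒ) → ℝ) := by
  have hs : ∀ i : Fin n, MeasurableSet
      {o : Fin n → Participant 𝒲 ℒ | A (o i) = a ∧ CY (o i) = true} := fun i =>
    ((measurable_A.comp (measurable_pi_apply i)) (measurableSet_singleton a)).inter
      ((measurable_CY.comp (measurable_pi_apply i)) (measurableSet_singleton true))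
  unfold armMean
  refine Measurable.div ?_ ?_
  · exact Finset.measurable_sum _ fun i _ =>
      Measurable.ite (hs i) (measurable_Y.comp (measurable_pi_apply i)) measurable_const
  · exact Finset.measurable_sum _ fun i _ =>
      Measurable.ite (hs i) measurable_const measurable_const

/-- The unadjusted estimator: difference between the two arms of the sample means of the observed
primary outcomes. -/
noncomputable def unadjusted (𝒲 ℒ : Type*) [MeasurableSpace 𝒲] [MeasurableSpace ℒ] :
    Estimator 𝒲 ℒ where
  val _ o := armMean true o - armMean false o
  measurable_val n := (measurable_armMean true n).sub (measurable_armMean false n)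
  observed_only n o o' h := by rw [armMean_congr true o o' h, armMean_congr false o o' h]

end Unadjusted

section Population

variable {𝒲 ℒ : Type*} [MeasurableSpace 𝒲] [MeasurableSpace ℒ]

/-- The law of a participant given `A = a`. -/
noncomputable def armLaw (P : Measure (Participant 𝒲 ℒ)) (a : Bool) : Measure (Participant 𝒲 ℒ) :=
  P[|{x | A x = a}]

/-- `p_l`, the probability that the short-term outcome is observed. -/
noncomputable def pL (P : Measure (Participant 𝒲 ℒ)) : ℝ := P.real {x | CL x = true}

/-- `p_y`, the probability that the primary outcome is observed. -/
noncomputable def pY (P : Measure (Participant 𝒲 ℒ)) : ℝ := P.real {x | CY x = true}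

/-- The model for a probability law `P`: 1:1 randomization independent of the baseline variables, independent and monotone
censoring, `p_y > 0`, and a primary outcome of finite variance. -/
structure Model (P : Measure (Participant 𝒲 ℒ)) : Prop where
  randomized : IndepFun A W P
  treated : P.real {x | A x = true} = 1 / 2
  control : P.real {x | A x = false} = 1 / 2
  censoring_indep : IndepFun (fun x => (CL x, CY x)) (fun x => (W x, A x, L x, Y x)) P
  censoring_mono : ∀ᵐ x ∂P, CY x = true → CL x = true
  pY_pos : 0 < pY P
  memLp_Y : MemLp Y 2 P

/-- `E_a(Y) = E(Y | A = a)`. -/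
noncomputable def meanY (P : Measure (Participant 𝒲 ℒ)) (a : Bool) : ℝ := ∫ x, Y x ∂(armLaw P a)

/-- `Δ = E(Y | A = 1) - E(Y | A = 0)`. -/
noncomputable def ate (P : Measure (Participant 𝒲 ℒ)) : ℝ := meanY P true - meanY P false

/-- `E_a(Y | W) = E(Y | W, A = a)`. It is a measurable function of `W`, determined up to null sets
for the law of `W` given `A = a`, which under randomization is the law of `W`. -/
noncomputable def regW (P : Measure (Participant 𝒲 ℒ)) (a : Bool) : Participant 𝒲 ℒ → ℝ :=
  (armLaw P a)[Y | MeasurableSpace.comap W inferInstance]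

/-- `E_a(Y | L, W) = E(Y | L, W, A = a)`. -/
noncomputable def regLW (P : Measure (Participant 𝒲 ℒ)) (a : Bool) : Participant 𝒲 ℒ → ℝ :=
  (armLaw P a)[Y | MeasurableSpace.comap (fun x => (L x, W x)) inferInstance]

/-- `Var_0(Y) + Var_1(Y)`. -/
noncomputable def totalVar (P : Measure (Participant 𝒲 ℒ)) : ℝ := ∑ a : Bool, Var[Y; armLaw P a]

/-- Treatment effect heterogeneity `γ`. -/
noncomputable def heterogeneity (P : Measure (Participant 𝒲 ℒ)) : ℝ :=
  Var[fun x => regW P true x - regW P false x; P] / totalVar P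

/-- `R²_W`. -/
noncomputable def rsqW (P : Measure (Participant 𝒲 ℒ)) : ℝ :=
  (∑ a : Bool, Var[regW P a; P]) / totalVar P

/-- `R²_{L|W}`. -/
noncomputable def rsqLW (P : Measure (Participant 𝒲 ℒ)) : ℝ :=
  (∑ a : Bool, Var[fun x => regLW P a x - regW P a x; armLaw P a]) / totalVar P

/-- The lower bound on the asymptotic variance of regular asymptotically linear estimators of
`Δ`. -/
noncomputable def varianceBound (P : Measure (Participant 𝒲 ℒ)) : ℝ :=
  Var[fun x => regW P true x - regW P false x; P]
    + ∑ a : Bool, 2 / pL P * Var[fun x => regLW P a x - regW P a x; armLaw P a]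
    + ∑ a : Bool, 2 / pY P * Var[fun x => Y x - regLW P a x; armLaw P a]

/-- `√n (T_n - Δ)` converges in distribution to `N(0, v)` when `T_n` is computed from the first
`n` terms of an i.i.d. sequence with law `P`. -/
def HasAVar (P : Measure (Participant 𝒲 ℒ)) [IsProbabilityMeasure P] (T : Estimator 𝒲 ℒ)
    (v : ℝ≥0) : Prop :=
  TendstoInDistribution
    (fun (n : ℕ) (ω : ℕ → Participant 𝒲 ℒ) => √(n : ℝ) * (T.val n (fun i : Fin n => ω i) - ate P))
    atTop (id : ℝ → ℝ) (fun _ => Measure.infinitePi fun _ : ℕ => P) (gaussianReal 0 v)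

/-- Asymptotic normality around `Δ`. -/
def AsympNormal (P : Measure (Participant 𝒲 ℒ)) [IsProbabilityMeasure P] (T : Estimator 𝒲 ℒ) :
    Prop :=
  ∃ v : ℝ≥0, HasAVar P T v

open Classical in
/-- The asymptotic variance of an asymptotically normal estimator (`0` for others). -/
noncomputable def AVar (P : Measure (Participant 𝒲 ℒ)) [IsProbabilityMeasure P]
    (T : Estimator 𝒲 ℒ) : ℝ≥0 :=
  if h : AsympNormal P T then h.choose else 0

/-- `T` is asymptotically normal and its asymptotic variance is the lower bound. Every efficient
regular asymptotically linear estimator has this property; regularity itself is not required. -/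
structure Efficient (P : Measure (Participant 𝒲 ℒ)) [IsProbabilityMeasure P]
    (T : Estimator 𝒲 ℒ) : Prop where
  asympNormal : AsympNormal P T
  attains : (AVar P T : ℝ) = varianceBound P

/-- Asymptotic relative efficiency `AVar(T₂) / AVar(T₁)` of `T₁` with respect to `T₂`; it is
`∞` when `AVar(T₁) = 0 < AVar(T₂)`. -/
noncomputable def ARE (P : Measure (Participant 𝒲 ℒ)) [IsProbabilityMeasure P]
    (T₁ T₂ : Estimator 𝒲 ℒ) : ℝ≥0∞ :=
  (AVar P T₂ : ℝ≥0∞) / (AVar P T₁ : ℝ≥0∞)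

end Population

end Trial

/-! The comparison reduces to the chain `γ ≤ 2q ≤ 2q / p_l`.

Splitting `Y` in each arm along the σ-algebras of `W` and `(L, W)` shows that the unexplained share
of the variance is `1 - R²_W - R²_{L|W}`. The efficiency bound divided by the total variance is
therefore `γ + (2/p_l) R²_{L|W} + (2/p_y)(1 - R²_W - R²_{L|W})` (`Model.varianceBound_eq`). The
central limit theorem and Slutsky's lemma give the unadjusted estimator asymptotic variance `2/p_y`
times the total variance (`Model.hasAVar_unadjusted`). Hence the ARE is `2/p_y` over the displayed
expression (`Model.are_unadjusted`), whose value is `γ + (2/p_y)(1 - q)` under `P₁` and `(2/p_l) q +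
(2/p_y)(1 - q)` under `P₂`, where heterogeneity vanishes.

The first inequality of the chain is the parallelogram law for the two arm regressions on `W`, which
have the same joint behaviour under `P` and under the arm laws by randomization; its defect is the
variance of their sum. The second is `p_l ≤ 1`. The defect vanishes exactly when the centred
regressions are opposite, and also exactly when `Y` is uncorrelated with functions of `W`, since
`cov(Y, f(W))` is half the covariance of that sum with `f(W)`. -/

namespace Trial

/-! ### Variance decompositions by conditional expectations. -/

section CondExp

variable {Ω : Type*} {m m' m₀ : MeasurableSpace Ω} {μ : Measure Ω} [IsProbabilityMeasure μ]

/-- **Law of total variance** in terms of the residual of the conditional expectation. -/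
theorem variance_eq_condExp_add_residual (hm : m ≤ m₀) {X : Ω → ℝ} (hX : MemLp X 2 μ) :
    Var[X; μ] = Var[μ[X | m]; μ] + Var[fun ω => X ω - (μ[X | m]) ω; μ] := by
  have hE : MemLp (μ[X | m]) 2 μ := hX.condExp one_le_two
  have hXi : Integrable X μ := hX.integrable one_le_two
  rw [← integral_condVar_add_variance_condExp hm hX, add_comm]
  congr 1
  have h0 : ∫ ω, (X ω - (μ[X | m]) ω) ∂μ = 0 := by
    rw [integral_sub hXi integrable_condExp, integral_condExp hm, sub_self]
  rw [variance_of_integral_eq_zero (X := fun ω => X ω - (μ[X | m]) ω) (hX.sub hE).aemeasurable h0]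
  exact integral_condExp hm

/-- Variance decomposition along two nested σ-algebras. -/
theorem variance_eq_condExp_add_add (hm : m ≤ m') (hm' : m' ≤ m₀) {X : Ω → ℝ} (hX : MemLp X 2 μ) :
    Var[X; μ] = Var[μ[X | m]; μ] + Var[fun ω => (μ[X | m']) ω - (μ[X | m]) ω; μ]
      + Var[fun ω => X ω - (μ[X | m']) ω; μ] := by
  -- The residual split is used twice, for `X` along `m'` and for `μ[X | m']` along `m`; the tower
  -- property identifies the coarser projection.
  have ht : μ[μ[X | m'] | m] =ᵐ[μ] μ[X | m] := condExp_condExp_of_le hm hm'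
  rw [variance_eq_condExp_add_residual hm' hX,
    variance_eq_condExp_add_residual (hm.trans hm') (hX.condExp one_le_two : MemLp (μ[X | m']) 2 μ),
    variance_congr ht]
  congr 2
  refine variance_congr ?_
  filter_upwards [ht] with ω hω
  rw [hω]

end CondExp

/-! ### Parallelogram law and its equality case. -/

section Variance

variable {Ω : Type*} {m₀ : MeasurableSpace Ω} {μ : Measure Ω} [IsProbabilityMeasure μ]
  {X Z : Ω → ℝ}

/-- The covariance terms cancel. This turns the bound on heterogeneity into nonnegativity of the
variance of the sum. -/
theorem variance_sub_add_variance_add (hX : MemLp X 2 μ) (hZ : MemLp Z 2 μ) :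
    Var[fun ω => X ω - Z ω; μ] + Var[fun ω => X ω + Z ω; μ] = 2 * (Var[X; μ] + Var[Z; μ]) := by
  rw [variance_fun_sub hX hZ, variance_fun_add hX hZ]
  ring

theorem variance_add_eq_zero_iff (hX : MemLp X 2 μ) (hZ : MemLp Z 2 μ) :
    Var[fun ω => X ω + Z ω; μ] = 0 ↔ ∀ᵐ ω ∂μ, X ω - ∫ x, X x ∂μ = -(Z ω - ∫ x, Z x ∂μ) := by
  have hm : ∫ ω, X ω + Z ω ∂μ = ∫ x, X x ∂μ + ∫ x, Z x ∂μ :=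
    integral_add (hX.integrable one_le_two) (hZ.integrable one_le_two)
  constructor
  · intro h
    filter_upwards [ae_eq_integral_of_variance_eq_zero (hX.add hZ) h] with ω hω
    simp only [Pi.add_apply] at hω
    rw [hm] at hω
    linarith
  · intro h
    have : (fun ω => X ω + Z ω) =ᵐ[μ] fun _ => ∫ x, X x ∂μ + ∫ x, Z x ∂μ := by
      filter_upwards [h] with ω hω
      linarith
    rw [variance_congr this, variance_eq_integral aemeasurable_const]
    simp

end Variance

/-! ### Arm laws, regressions on `W`, and heterogeneity. -/

section Population

variable {𝒲 ℒ : Type*} [MeasurableSpace 𝒲] [MeasurableSpace ℒ]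

theorem measurable_W : Measurable (W : Participant 𝒲 ℒ → 𝒲) := by
  unfold W; fun_prop

theorem measurable_L : Measurable (L : Participant 𝒲 ℒ → ℒ) := by
  unfold L; fun_prop

theorem measurableSet_arm (a : Bool) : MeasurableSet {x : Participant 𝒲 ℒ | A x = a} :=
  measurable_A (measurableSet_singleton a)

theorem Model.real_arm {P : Measure (Participant 𝒲 ℒ)} (hP : Model P) (a : Bool) : P.real {x | A x = a} = 1 / 2 := by
  cases a
  exacts [hP.control, hP.treated]

variable {P : Measure (Participant 𝒲 ℒ)} [IsProbabilityMeasure P]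

theorem Model.measure_arm (hP : Model P) (a : Bool) : P {x | A x = a} = 2⁻¹ := by
  have h := hP.real_arm a
  rw [measureReal_def] at h
  rw [← ENNReal.ofReal_toReal (measure_ne_top P {x | A x = a}), h, one_div,
    ENNReal.ofReal_inv_of_pos two_pos]
  simp

theorem Model.armLaw_eq (hP : Model P) (a : Bool) :
    armLaw P a = (2 : ℝ≥0∞) • P.restrict {x | A x = a} := by
  rw [armLaw, ProbabilityTheory.cond, hP.measure_arm a, inv_inv]

theorem Model.isProbabilityMeasure_armLaw (hP : Model P) (a : Bool) :
    IsProbabilityMeasure (armLaw P a) :=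
  cond_isProbabilityMeasure (by rw [hP.measure_arm a]; simp)

theorem Model.integral_armLaw (hP : Model P) (a : Bool) (f : Participant 𝒲 ℒ → ℝ) :
    ∫ x, f x ∂(armLaw P a) = 2 * ∫ x in {x | A x = a}, f x ∂P := by
  rw [hP.armLaw_eq a, integral_smul_measure]
  simp

theorem Model.memLp_armLaw (hP : Model P) (a : Bool) {f : Participant 𝒲 ℒ → ℝ} {p : ℝ≥0∞}
    (hf : MemLp f p P) : MemLp f p (armLaw P a) := by
  rw [hP.armLaw_eq a]
  exact (hf.restrict _).smul_measure (by simp)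

theorem Model.integral_eq_armLaw (hP : Model P) {f : Participant 𝒲 ℒ → ℝ} (hf : Integrable f P) :
    ∫ x, f x ∂P = (∫ x, f x ∂(armLaw P true) + ∫ x, f x ∂(armLaw P false)) / 2 := by
  have hc : {x : Participant 𝒲 ℒ | A x = true}ᶜ = {x | A x = false} := by
    ext x; simp
  rw [hP.integral_armLaw, hP.integral_armLaw, ← integral_add_compl (measurableSet_arm true) hf, hc]
  ring

/-- Under randomization the baseline variables have the same law in each arm. -/
theorem Model.map_W_armLaw (hP : Model P) (a : Bool) : (armLaw P a).map W = P.map W := by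
  ext s hs
  rw [Measure.map_apply measurable_W hs, Measure.map_apply measurable_W hs, armLaw,
    cond_apply (measurableSet_arm a), hP.measure_arm a, inv_inv]
  have := hP.randomized.measure_inter_preimage_eq_mul {a} s (measurableSet_singleton a) hs
  rw [show {x : Participant 𝒲 ℒ | A x = a} = A ⁻¹' {a} from rfl, this,
    show A ⁻¹' {a} = {x : Participant 𝒲 ℒ | A x = a} from rfl, hP.measure_arm a, ← mul_assoc,
    ENNReal.mul_inv_cancel (by simp) (by simp), one_mul]

theorem comap_W_le :
    MeasurableSpace.comap (W : Participant 𝒲 ℒ → 𝒲) inferInstance ≤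
      (inferInstance : MeasurableSpace (Participant 𝒲 ℒ)) :=
  measurable_W.comap_le

theorem comap_LW_le :
    MeasurableSpace.comap (fun x : Participant 𝒲 ℒ => (L x, W x)) inferInstance ≤
      (inferInstance : MeasurableSpace (Participant 𝒲 ℒ)) :=
  (measurable_L.prodMk measurable_W).comap_le

theorem comap_W_le_comap_LW :
    MeasurableSpace.comap (W : Participant 𝒲 ℒ → 𝒲) inferInstance ≤
      MeasurableSpace.comap (fun x : Participant 𝒲 ℒ => (L x, W x)) inferInstance := by
  rintro _ ⟨s, hs, rfl⟩
  exact ⟨Prod.snd ⁻¹' s, measurable_snd hs, rfl⟩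

/-- The regression is a conditional expectation under `armLaw P a`, but it is integrated under `P`.
Factoring this version through `W` allows the transfer, because `W` has the same law under both
measures. -/
theorem exists_regW_eq_comp (P : Measure (Participant 𝒲 ℒ)) (a : Bool) :
    ∃ g : 𝒲 → ℝ, Measurable g ∧ regW P a = g ∘ W := by
  have h : Measurable[MeasurableSpace.comap W inferInstance] (regW P a) :=
    stronglyMeasurable_condExp.measurable
  exact h.exists_eq_measurable_comp

theorem Model.integral_comp_W (hP : Model P) (a : Bool) {g : 𝒲 → ℝ} (hg : Measurable g) :
    ∫ x, g (W x) ∂(armLaw P a) = ∫ x, g (W x) ∂P := by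
  rw [← integral_map measurable_W.aemeasurable hg.aestronglyMeasurable, hP.map_W_armLaw a,
    integral_map measurable_W.aemeasurable hg.aestronglyMeasurable]

theorem Model.memLp_regW (hP : Model P) (a : Bool) : MemLp (regW P a) 2 P := by
  have := hP.isProbabilityMeasure_armLaw a
  have h : MemLp (regW P a) 2 (armLaw P a) := (hP.memLp_armLaw a hP.memLp_Y).condExp one_le_two
  obtain ⟨g, hg, hgW⟩ := exists_regW_eq_comp P a
  rw [hgW] at h ⊢
  rwa [← memLp_map_measure_iff hg.aestronglyMeasurable measurable_W.aemeasurable,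
    ← hP.map_W_armLaw a, memLp_map_measure_iff hg.aestronglyMeasurable measurable_W.aemeasurable]

theorem Model.variance_regW (hP : Model P) (a : Bool) :
    Var[regW P a; armLaw P a] = Var[regW P a; P] := by
  obtain ⟨g, hg, hgW⟩ := exists_regW_eq_comp P a
  rw [hgW, ← variance_map hg.aemeasurable measurable_W.aemeasurable, hP.map_W_armLaw a,
    variance_map hg.aemeasurable measurable_W.aemeasurable]

theorem Model.integral_regW (hP : Model P) (a : Bool) : ∫ x, regW P a x ∂P = meanY P a := by
  have := hP.isProbabilityMeasure_armLaw a
  have h : ∫ x, regW P a x ∂(armLaw P a) = meanY P a := integral_condExp comap_W_le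
  obtain ⟨g, hg, hgW⟩ := exists_regW_eq_comp P a
  rw [← h, hgW]
  exact (hP.integral_comp_W a hg).symm

theorem Model.variance_Y (hP : Model P) (a : Bool) :
    Var[Y; armLaw P a] = Var[regW P a; P] + Var[fun x => regLW P a x - regW P a x; armLaw P a]
      + Var[fun x => Y x - regLW P a x; armLaw P a] := by
  have := hP.isProbabilityMeasure_armLaw a
  rw [← hP.variance_regW a]
  exact variance_eq_condExp_add_add comap_W_le_comap_LW comap_LW_le
    (hP.memLp_armLaw a hP.memLp_Y)

theorem Model.totalVar_eq (hP : Model P) :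
    totalVar P = ∑ a : Bool, Var[regW P a; P]
      + ∑ a : Bool, Var[fun x => regLW P a x - regW P a x; armLaw P a]
      + ∑ a : Bool, Var[fun x => Y x - regLW P a x; armLaw P a] := by
  rw [totalVar, ← Finset.sum_add_distrib, ← Finset.sum_add_distrib]
  exact Finset.sum_congr rfl fun a _ => hP.variance_Y a

theorem totalVar_nonneg (P : Measure (Participant 𝒲 ℒ)) : 0 ≤ totalVar P :=
  Finset.sum_nonneg fun _ _ => variance_nonneg _ _

theorem heterogeneity_nonneg (P : Measure (Participant 𝒲 ℒ)) : 0 ≤ heterogeneity P :=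
  div_nonneg (variance_nonneg _ _) (totalVar_nonneg P)

/-- The parallelogram law divided by the total variance. If that is zero, both sides are zero by the
division convention. -/
theorem Model.heterogeneity_add (hP : Model P) :
    heterogeneity P + Var[fun x => regW P true x + regW P false x; P] / totalVar P
      = 2 * rsqW P := by
  rw [heterogeneity, rsqW, ← add_div,
    variance_sub_add_variance_add (hP.memLp_regW true) (hP.memLp_regW false), Fintype.sum_bool]
  ring

theorem Model.heterogeneity_le (hP : Model P) : heterogeneity P ≤ 2 * rsqW P := by
  rw [← hP.heterogeneity_add]
  exact le_add_of_nonneg_right (div_nonneg (variance_nonneg _ _) (totalVar_nonneg P))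

theorem Model.heterogeneity_eq_iff (hP : Model P) (h : totalVar P ≠ 0) :
    heterogeneity P = 2 * rsqW P ↔ Var[fun x => regW P true x + regW P false x; P] = 0 := by
  rw [← hP.heterogeneity_add, left_eq_add, div_eq_zero_iff, or_iff_left h]

/-- `2 E{Y f(W)} = E[{E_1(Y | W) + E_0(Y | W)} f(W)]`, for covariances. -/
theorem Model.covariance_Y_comp_W (hP : Model P) {f : 𝒲 → ℝ} (hf : Measurable f)
    (hf2 : MemLp (fun x => f (W x)) 2 P) :
    cov[Y, fun x => f (W x); P]
      = cov[fun x => regW P true x + regW P false x, fun x => f (W x); P] / 2 := by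
  -- Within the arm `f(W)` is pulled out of the conditional expectation; the result is a function of
  -- `W`, so the arm law may be replaced by `P`.
  have hmul : ∀ a, ∫ x, Y x * f (W x) ∂(armLaw P a) = ∫ x, regW P a x * f (W x) ∂P := by
    intro a
    have := hP.isProbabilityMeasure_armLaw a
    have hi : Integrable (Y * fun x => f (W x)) (armLaw P a) :=
      (hP.memLp_armLaw a hP.memLp_Y).integrable_mul (hP.memLp_armLaw a hf2)
    have hfm : StronglyMeasurable[MeasurableSpace.comap W inferInstance]
        (fun x : Participant 𝒲 ℒ => f (W x)) :=
      (hf.comp (comap_measurable W)).stronglyMeasurable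
    have hc := condExp_mul_of_stronglyMeasurable_right hfm hi
      ((hP.memLp_armLaw a hP.memLp_Y).integrable one_le_two)
    have h1 : ∫ x, Y x * f (W x) ∂(armLaw P a) = ∫ x, regW P a x * f (W x) ∂(armLaw P a) := by
      rw [← integral_condExp (comap_W_le (ℒ := ℒ))]
      exact integral_congr_ae hc
    obtain ⟨g, hg, hgW⟩ := exists_regW_eq_comp P a
    rw [h1, hgW]
    exact hP.integral_comp_W a (hg.mul hf)
  have hr := hP.memLp_regW
  have hi : ∀ a, Integrable (fun x => regW P a x * f (W x)) P := fun a => (hr a).integrable_mul hf2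
  have e1 : ∫ x, Y x * f (W x) ∂P
      = (∫ x, (regW P true x + regW P false x) * f (W x) ∂P) / 2 := by
    rw [hP.integral_eq_armLaw (f := fun x => Y x * f (W x)) (hP.memLp_Y.integrable_mul hf2),
      hmul, hmul, ← integral_add (hi true) (hi false)]
    simp_rw [add_mul]
  have e2 : ∫ x, Y x ∂P = (∫ x, (regW P true x + regW P false x) ∂P) / 2 := by
    rw [hP.integral_eq_armLaw (hP.memLp_Y.integrable one_le_two),
      integral_add ((hr true).integrable one_le_two) ((hr false).integrable one_le_two),
      hP.integral_regW, hP.integral_regW]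
    rfl
  rw [covariance_eq_sub hP.memLp_Y hf2,
    covariance_eq_sub (X := fun x => regW P true x + regW P false x) ((hr true).add (hr false)) hf2]
  simp only [Pi.mul_apply]
  rw [e1, e2]
  ring

theorem Model.variance_regW_add_eq_zero_iff (hP : Model P) :
    Var[fun x => regW P true x + regW P false x; P] = 0 ↔
      ∀ f : 𝒲 → ℝ, Measurable f → MemLp (fun x => f (W x)) 2 P →
        cov[Y, fun x => f (W x); P] = 0 := by
  have hr := hP.memLp_regW
  have hadd : MemLp (fun x => regW P true x + regW P false x) 2 P := (hr true).add (hr false)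
  constructor
  · intro h f hf hf2
    have hae := ae_eq_integral_of_variance_eq_zero hadd h
    rw [hP.covariance_Y_comp_W hf hf2, covariance, integral_eq_zero_of_ae, zero_div]
    filter_upwards [hae] with x hx
    rw [hx, sub_self, zero_mul, Pi.zero_apply]
  · intro h
    obtain ⟨g, hg, hgW⟩ := exists_regW_eq_comp P true
    obtain ⟨g', hg', hgW'⟩ := exists_regW_eq_comp P false
    have he : (fun x => regW P true x + regW P false x) = fun x => (g + g') (W x) := by
      rw [hgW, hgW']
      rfl
    -- The sum of the regressions serves as its own test function: its covariance with `Y` is half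
    -- its variance.
    have h0 := h (g + g') (hg.add hg') (he ▸ hadd)
    rw [hP.covariance_Y_comp_W (hg.add hg') (he ▸ hadd), ← he,
      covariance_self hadd.aemeasurable] at h0
    linarith

theorem Model.pY_le_pL (hP : Model P) : pY P ≤ pL P :=
  ENNReal.toReal_mono (measure_ne_top _ _) (measure_mono_ae hP.censoring_mono)

theorem Model.pL_pos (hP : Model P) : 0 < pL P := hP.pY_pos.trans_le hP.pY_le_pL

end Population

/-! ### Convergence in distribution to a constant. -/

section InMeasure

/-- Convergence in distribution to a constant implies convergence in probability. -/
theorem tendstoInMeasure_of_tendstoInDistribution_const {Ω Ω' : Type*} {_ : MeasurableSpace Ω}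
    {_ : MeasurableSpace Ω'} {μ : Measure Ω} {ν : Measure Ω'} [IsProbabilityMeasure μ]
    [IsProbabilityMeasure ν] {X : ℕ → Ω → ℝ} {c : ℝ}
    (h : TendstoInDistribution X atTop (fun _ : Ω' => c) (fun _ => μ) ν) :
    TendstoInMeasure μ X atTop (fun _ => c) := by
  rw [tendstoInMeasure_iff_dist]
  intro ε hε
  have hE : MeasurableSet {x : ℝ | ε ≤ dist x c} :=
    measurableSet_le measurable_const (measurable_id.dist measurable_const)
  -- The portmanteau theorem needs a frontier that is null for the Dirac mass at `c`.
  have hc : c ∉ frontier {x : ℝ | ε ≤ dist x c} := by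
    have hcl : IsClosed {x : ℝ | ε ≤ dist x c} :=
      isClosed_le continuous_const (continuous_id.dist continuous_const)
    intro hmem
    have : ε ≤ dist c c := hcl.frontier_subset hmem
    rw [dist_self] at this
    linarith
  have hmap : ν.map (fun _ : Ω' => c) = Measure.dirac c := by simp [Measure.map_const]
  have key := ProbabilityMeasure.tendsto_measure_of_null_frontier_of_tendsto' h.tendsto
    (E := {x : ℝ | ε ≤ dist x c}) (by
      simp only [ProbabilityMeasure.coe_mk, hmap]
      rw [Measure.dirac_apply' _ isClosed_frontier.measurableSet]
      simp [hc])
  simp only [ProbabilityMeasure.coe_mk, hmap] at key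
  rw [Measure.dirac_apply' _ hE] at key
  have hc' : c ∉ {x : ℝ | ε ≤ dist x c} := by simpa using hε
  rw [Set.indicator_of_notMem hc'] at key
  refine key.congr fun n => ?_
  rw [Measure.map_apply_of_aemeasurable (h.forall_aemeasurable n) hE]
  rfl

end InMeasure

/-! ### Asymptotic variance of the unadjusted estimator. -/

section Unadjusted

variable {𝒲 ℒ : Type*}

/-- Indicator that a participant is in arm `a` with observed primary outcome. -/
noncomputable def seen (a : Bool) (x : Participant 𝒲 ℒ) : ℝ :=
  if A x = a ∧ CY x = true then 1 else 0

theorem seen_sq (a : Bool) (x : Participant 𝒲 ℒ) : seen a x ^ 2 = seen a x := by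
  unfold seen; split_ifs <;> simp

/-- The arms are disjoint; this removes the cross term from the variance of the influence function.
-/
theorem seen_true_mul_seen_false (x : Participant 𝒲 ℒ) : seen true x * seen false x = 0 := by
  unfold seen; split_ifs <;> simp_all

theorem armMean_eq (a : Bool) {n : ℕ} (o : Fin n → Participant 𝒲 ℒ) :
    armMean a o = (∑ i, seen a (o i) * Y (o i)) / ∑ i, seen a (o i) := by
  unfold armMean seen
  simp

variable [MeasurableSpace 𝒲] [MeasurableSpace ℒ]

/-- The primary outcome centred at its arm mean, if the participant is in arm `a` and the outcome is
observed, and `0` otherwise. -/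
noncomputable def resid (P : Measure (Participant 𝒲 ℒ)) (a : Bool) (x : Participant 𝒲 ℒ) : ℝ :=
  seen a x * (Y x - meanY P a)

theorem measurable_seen (a : Bool) : Measurable (seen a : Participant 𝒲 ℒ → ℝ) :=
  Measurable.ite ((measurable_A (measurableSet_singleton a)).inter
    (measurable_CY (measurableSet_singleton true))) measurable_const measurable_const

theorem measurable_resid (P : Measure (Participant 𝒲 ℒ)) (a : Bool) : Measurable (resid P a) :=
  (measurable_seen a).mul (measurable_Y.sub_const _)

variable {P : Measure (Participant 𝒲 ℒ)} [IsProbabilityMeasure P]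

/-- Independent censoring factors out `p_y`, and the arm probability contributes `1/2`. The moments
of `seen` and `resid` are the cases where `h` is constant, centred at the arm mean, or the square of
the latter. -/
theorem Model.integral_seen_mul (hP : Model P) (a : Bool) {h : ℝ → ℝ} (hh : Measurable h) :
    ∫ x, seen a x * h (Y x) ∂P = pY P / 2 * ∫ x, h (Y x) ∂(armLaw P a) := by
  have hind : IndepFun (fun x : Participant 𝒲 ℒ => if CY x = true then (1 : ℝ) else 0)
      (fun x => {x | A x = a}.indicator (fun x => h (Y x)) x) P := by
    have := hP.censoring_indep.comp (_mγ := inferInstance) (_mγ' := inferInstance)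
      (φ := fun c : Bool × Bool => if c.2 = true then (1 : ℝ) else 0)
      (ψ := fun p : 𝒲 × Bool × ℒ × ℝ => if p.2.1 = a then h p.2.2.2 else 0)
      (Measurable.ite (measurable_snd (measurableSet_singleton true)) measurable_const
        measurable_const)
      (Measurable.ite ((measurable_fst.comp measurable_snd) (measurableSet_singleton a))
        (hh.comp (by fun_prop)) measurable_const)
    refine this.congr (ae_of_all _ fun x => rfl) (ae_of_all _ fun x => ?_)
    simp [Set.indicator_apply]
  have hmc : Measurable fun x : Participant 𝒲 ℒ => if CY x = true then (1 : ℝ) else 0 :=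
    Measurable.ite (measurable_CY (measurableSet_singleton true)) measurable_const measurable_const
  have hmi : Measurable ({x : Participant 𝒲 ℒ | A x = a}.indicator (fun x => h (Y x))) :=
    (hh.comp measurable_Y).indicator (measurableSet_arm a)
  have hc : ∫ x, (if CY x = true then (1 : ℝ) else 0) ∂P = pY P := by
    have hs : MeasurableSet {x : Participant 𝒲 ℒ | CY x = true} :=
      measurable_CY (measurableSet_singleton true)
    rw [pY, ← integral_indicator_one hs]
    congr 1
    ext x
    simp [Set.indicator_apply]
  calc ∫ x, seen a x * h (Y x) ∂P
      = ∫ x, (if CY x = true then (1 : ℝ) else 0)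
          * {x | A x = a}.indicator (fun x => h (Y x)) x ∂P := by
        congr 1
        ext x
        by_cases h1 : A x = a <;> by_cases h2 : CY x = true <;> simp [seen, h1, h2]
    _ = pY P * ∫ x in {x | A x = a}, h (Y x) ∂P := by
        rw [hind.integral_fun_mul_eq_mul_integral hmc.aestronglyMeasurable
          hmi.aestronglyMeasurable, hc, integral_indicator (measurableSet_arm a)]
    _ = pY P / 2 * ∫ x, h (Y x) ∂(armLaw P a) := by
        rw [hP.integral_armLaw]
        ring

theorem Model.memLp_resid (hP : Model P) (a : Bool) : MemLp (resid P a) 2 P := by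
  refine (hP.memLp_Y.sub (memLp_const (meanY P a))).mono
    (measurable_resid P a).aestronglyMeasurable (ae_of_all _ fun x => ?_)
  unfold resid seen
  split_ifs <;> simp

theorem integrable_seen (P : Measure (Participant 𝒲 ℒ)) [IsProbabilityMeasure P] (a : Bool) :
    Integrable (seen a) P := by
  refine Integrable.mono (integrable_const (1 : ℝ)) (measurable_seen a).aestronglyMeasurable
    (ae_of_all _ fun x => ?_)
  unfold seen
  split_ifs <;> simp

theorem Model.integral_seen (hP : Model P) (a : Bool) : ∫ x, seen a x ∂P = pY P / 2 := by
  have := hP.isProbabilityMeasure_armLaw a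
  simpa using hP.integral_seen_mul a (h := fun _ => 1) measurable_const

theorem Model.integral_resid (hP : Model P) (a : Bool) : ∫ x, resid P a x ∂P = 0 := by
  have := hP.isProbabilityMeasure_armLaw a
  have h := hP.integral_seen_mul a (h := fun y => y - meanY P a) (by fun_prop)
  rw [integral_sub ((hP.memLp_armLaw a hP.memLp_Y).integrable one_le_two) (integrable_const _),
    integral_const, probReal_univ, one_smul] at h
  rw [show ∫ x, Y x ∂(armLaw P a) = meanY P a from rfl, sub_self, mul_zero] at h
  exact h

theorem Model.integral_resid_sq (hP : Model P) (a : Bool) :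
    ∫ x, resid P a x ^ 2 ∂P = pY P / 2 * Var[Y; armLaw P a] := by
  rw [variance_eq_integral measurable_Y.aemeasurable]
  have h := hP.integral_seen_mul a (h := fun y => (y - meanY P a) ^ 2) (by fun_prop)
  rw [show ∫ x, Y x ∂(armLaw P a) = meanY P a from rfl, ← h]
  simp_rw [resid, mul_pow, seen_sq]

/-- Influence function of the unadjusted estimator. -/
noncomputable def influence (P : Measure (Participant 𝒲 ℒ)) (x : Participant 𝒲 ℒ) : ℝ :=
  2 / pY P * (resid P true x - resid P false x)

theorem measurable_influence (P : Measure (Participant 𝒲 ℒ)) : Measurable (influence P) :=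
  ((measurable_resid P true).sub (measurable_resid P false)).const_mul _

theorem Model.memLp_influence (hP : Model P) : MemLp (influence P) 2 P :=
  ((hP.memLp_resid true).sub (hP.memLp_resid false)).const_mul _

theorem Model.integral_influence (hP : Model P) : ∫ x, influence P x ∂P = 0 := by
  simp_rw [influence]
  rw [integral_const_mul, integral_sub ((hP.memLp_resid true).integrable one_le_two)
    ((hP.memLp_resid false).integrable one_le_two), hP.integral_resid, hP.integral_resid]
  simp

theorem Model.variance_influence (hP : Model P) :
    Var[influence P; P] = 2 / pY P * totalVar P := by
  rw [variance_of_integral_eq_zero (measurable_influence P).aemeasurable hP.integral_influence]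
  have hsq : ∀ x, influence P x ^ 2
      = (2 / pY P) ^ 2 * (resid P true x ^ 2 + resid P false x ^ 2) := by
    intro x
    have := seen_true_mul_seen_false x
    unfold influence resid
    linear_combination (-(2 / pY P) ^ 2 * 2 * (Y x - meanY P true) * (Y x - meanY P false)) * this
  simp_rw [hsq]
  rw [integral_const_mul, integral_add (hP.memLp_resid true).integrable_sq
    (hP.memLp_resid false).integrable_sq, hP.integral_resid_sq, hP.integral_resid_sq, totalVar,
    Fintype.sum_bool]
  have := hP.pY_pos.ne'
  field_simp

/-! ### Limit theorems along the i.i.d. sequence. -/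

section Sample

variable {f : Participant 𝒲 ℒ → ℝ}

theorem iIndepFun_sample (P : Measure (Participant 𝒲 ℒ)) [IsProbabilityMeasure P]
    (hf : Measurable f) :
    iIndepFun (fun (i : ℕ) ω => f (ω i)) (Measure.infinitePi fun _ : ℕ => P) :=
  iIndepFun_infinitePi (P := fun _ : ℕ => P) (X := fun _ => f) fun _ => hf

theorem measurePreserving_sample (P : Measure (Participant 𝒲 ℒ)) [IsProbabilityMeasure P] (i : ℕ) :
    MeasurePreserving (fun ω : ℕ → Participant 𝒲 ℒ => ω i) (Measure.infinitePi fun _ : ℕ => P) P :=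
  measurePreserving_eval_infinitePi (fun _ : ℕ => P) i

theorem map_sample (P : Measure (Participant 𝒲 ℒ)) [IsProbabilityMeasure P] (hf : Measurable f)
    (i : ℕ) : (Measure.infinitePi fun _ : ℕ => P).map (fun ω => f (ω i)) = P.map f := by
  conv_rhs => rw [← (measurePreserving_sample P i).map_eq]
  rw [Measure.map_map hf (measurePreserving_sample P i).measurable]
  rfl

theorem identDistrib_sample (P : Measure (Participant 𝒲 ℒ)) [IsProbabilityMeasure P]
    (hf : Measurable f) (i j : ℕ) :
    IdentDistrib (fun ω : ℕ → Participant 𝒲 ℒ => f (ω i)) (fun ω => f (ω j))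
      (Measure.infinitePi fun _ : ℕ => P) (Measure.infinitePi fun _ : ℕ => P) where
  aemeasurable_fst := (hf.comp (measurable_pi_apply i)).aemeasurable
  aemeasurable_snd := (hf.comp (measurable_pi_apply j)).aemeasurable
  map_eq := by rw [map_sample P hf, map_sample P hf]

theorem integral_sample (P : Measure (Participant 𝒲 ℒ)) [IsProbabilityMeasure P]
    (hf : Measurable f) (i : ℕ) :
    ∫ ω, f (ω i) ∂(Measure.infinitePi fun _ : ℕ => P) = ∫ x, f x ∂P := by
  conv_rhs => rw [← (measurePreserving_sample P i).map_eq]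
  rw [integral_map (measurePreserving_sample P i).aemeasurable hf.aestronglyMeasurable]

/-- Central limit theorem for a centred function of one participant. -/
theorem tendstoInDistribution_sample (hf : Measurable f) (hf2 : MemLp f 2 P)
    (h0 : ∫ x, f x ∂P = 0) :
    TendstoInDistribution (fun (n : ℕ) ω => (√(n : ℝ))⁻¹ * ∑ i ∈ Finset.range n, f (ω i)) atTop
      (id : ℝ → ℝ) (fun _ => Measure.infinitePi fun _ : ℕ => P)
      (gaussianReal 0 Var[f; P].toNNReal) := by
  have hv : Var[fun ω : ℕ → Participant 𝒲 ℒ => f (ω 0); Measure.infinitePi fun _ : ℕ => P]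
      = Var[f; P] := by
    conv_rhs => rw [← (measurePreserving_sample P 0).map_eq]
    rw [variance_map hf.aemeasurable (measurePreserving_sample P 0).aemeasurable]
    rfl
  have := tendstoInDistribution_inv_sqrt_mul_sum_sub
    (P := Measure.infinitePi fun _ : ℕ => P) (X := fun i ω => f (ω i)) (Y := (id : ℝ → ℝ))
    (P' := gaussianReal 0 Var[f; P].toNNReal)
    (by rw [hv]; exact HasLaw.id) (hf2.comp_measurePreserving (measurePreserving_sample P 0))
    (iIndepFun_sample P hf) (fun i => identDistrib_sample P hf i 0)
  simpa [integral_sample P hf, h0] using this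

theorem tendsto_average_sample (hf : Measurable f) (hfi : Integrable f P) :
    ∀ᵐ ω ∂(Measure.infinitePi fun _ : ℕ => P),
      Tendsto (fun n : ℕ => (∑ i ∈ Finset.range n, f (ω i)) / n) atTop (𝓝 (∫ x, f x ∂P)) := by
  have := strong_law_ae_real (μ := Measure.infinitePi fun _ : ℕ => P) (fun i ω => f (ω i))
    ((measurePreserving_sample P 0).integrable_comp_of_integrable hfi)
    (fun i j hij => (iIndepFun_sample P hf).indepFun hij) (fun i => identDistrib_sample P hf i 0)
  simpa only [integral_sample P hf] using this

end Sample

/-- The arm mean is asymptotically linear. -/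
theorem Model.tendstoInMeasure_armMean (hP : Model P) (a : Bool) :
    TendstoInMeasure (Measure.infinitePi fun _ : ℕ => P)
      (fun (n : ℕ) ω => √(n : ℝ) * (armMean a (fun i : Fin n => ω i) - meanY P a)
        - 2 / pY P * ((√(n : ℝ))⁻¹ * ∑ i ∈ Finset.range n, resid P a (ω i)))
      atTop (fun _ => 0) := by
  set μ := Measure.infinitePi fun _ : ℕ => P
  set S : ℕ → (ℕ → Participant 𝒲 ℒ) → ℝ := fun n ω => ∑ i ∈ Finset.range n, seen a (ω i)
  set Z : ℕ → (ℕ → Participant 𝒲 ℒ) → ℝ :=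
    fun n ω => (√(n : ℝ))⁻¹ * ∑ i ∈ Finset.range n, resid P a (ω i)
  -- Error of the random normalization: `S n / n` tends to `p_y / 2`. The linearization remainder
  -- will be `Z * V`.
  set V : ℕ → (ℕ → Participant 𝒲 ℒ) → ℝ := fun n ω => (S n ω / n)⁻¹ - 2 / pY P
  have hpos : 0 < pY P / 2 := half_pos hP.pY_pos
  have hSm : ∀ n, Measurable (S n) := fun n =>
    Finset.measurable_sum _ fun i _ => (measurable_seen a).comp (measurable_pi_apply i)
  have hVm : ∀ n, Measurable (V n) := fun n => (((hSm n).div_const _).inv).sub_const _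
  have hZm : ∀ n, Measurable (Z n) := fun n => (Finset.measurable_sum _ fun i _ =>
    (measurable_resid P a).comp (measurable_pi_apply i)).const_mul _
  have hlln : ∀ᵐ ω ∂μ, Tendsto (fun n : ℕ => S n ω / n) atTop (𝓝 (pY P / 2)) := by
    have := tendsto_average_sample (measurable_seen a) (integrable_seen P a)
    rwa [hP.integral_seen a] at this
  have hV : TendstoInMeasure μ V atTop (fun _ => 0) := by
    refine tendstoInMeasure_of_tendsto_ae (fun n => (hVm n).aestronglyMeasurable) ?_
    filter_upwards [hlln] with ω hω
    have := (hω.inv₀ hpos.ne').sub_const (2 / pY P)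
    rwa [inv_div, sub_self] at this
  have hZ := tendstoInDistribution_sample (measurable_resid P a) (hP.memLp_resid a)
    (hP.integral_resid a)
  -- Slutsky: `Z` converges in distribution and `V` tends to `0` in probability.
  have hprod : TendstoInDistribution (fun n ω => Z n ω * V n ω) atTop (fun _ : ℝ => (0 : ℝ))
      (fun _ => μ) (gaussianReal 0 Var[resid P a; P].toNNReal) := by
    have := hZ.continuous_comp_prodMk_of_tendstoInMeasure_const
      (g := fun p : ℝ × ℝ => p.1 * p.2) (by fun_prop) hV (fun n => (hVm n).aemeasurable)
    simpa using this
  set R : ℕ → (ℕ → Participant 𝒲 ℒ) → ℝ := fun n ω =>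
    √(n : ℝ) * (armMean a (fun i : Fin n => ω i) - meanY P a) - 2 / pY P * Z n ω
  have hRm : ∀ n, Measurable (R n) := fun n =>
    ((((measurable_armMean a n).comp (measurable_pi_lambda _ fun i =>
      measurable_pi_apply (i : ℕ))).sub_const _).const_mul _).sub ((hZm n).const_mul _)
  -- `R = Z * V` holds exactly once `n > 0` and `S n ≠ 0`, which is almost surely eventually the
  -- case. With no observed outcome the arm mean has its default value `0` and the identity can
  -- fail.
  have hrest : TendstoInMeasure μ (fun n ω => R n ω - Z n ω * V n ω) atTop (fun _ => 0) := by
    refine tendstoInMeasure_of_tendsto_ae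
      (fun n => ((hRm n).sub ((hZm n).mul (hVm n))).aestronglyMeasurable) ?_
    filter_upwards [hlln] with ω hω
    refine tendsto_const_nhds.congr' ?_
    filter_upwards [hω.eventually_const_lt hpos, eventually_gt_atTop 0] with n hn hn0
    have hn' : (0 : ℝ) < n := by exact_mod_cast hn0
    have hS : S n ω ≠ 0 := by
      intro h
      rw [h, zero_div] at hn
      exact lt_irrefl _ hn
    have hres : ∑ i ∈ Finset.range n, resid P a (ω i)
        = ∑ i ∈ Finset.range n, seen a (ω i) * Y (ω i) - meanY P a * S n ω := by
      simp only [resid, S, mul_sub, Finset.sum_sub_distrib, Finset.mul_sum]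
      congr 1
      exact Finset.sum_congr rfl fun i _ => mul_comm _ _
    have harm : armMean a (fun i : Fin n => ω i)
        = (∑ i ∈ Finset.range n, seen a (ω i) * Y (ω i)) / S n ω := by
      simp only [armMean_eq, S, Finset.sum_range]
    have hsq : √(n : ℝ) * √n = n := Real.mul_self_sqrt hn'.le
    have hsne : √(n : ℝ) ≠ 0 := (Real.sqrt_pos.2 hn').ne'
    simp only [R, V, Z, harm, hres]
    generalize ∑ i ∈ Finset.range n, seen a (ω i) * Y (ω i) = B
    generalize √(n : ℝ) = s at hsq hsne
    rw [← hsq]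
    field_simp
    ring
  have hR := hprod.add_of_tendstoInMeasure_const hrest
    fun n => ((hRm n).sub ((hZm n).mul (hVm n))).aemeasurable
  refine tendstoInMeasure_of_tendstoInDistribution_const
    (ν := gaussianReal 0 Var[resid P a; P].toNNReal) ?_
  convert hR using 1
  · ext n ω
    simp [R, Z]
  · simp

/-- Asymptotic normality of the unadjusted estimator. -/
theorem Model.hasAVar_unadjusted (hP : Model P) :
    HasAVar P (unadjusted 𝒲 ℒ) (2 / pY P * totalVar P).toNNReal := by
  have h := tendstoInDistribution_sample (measurable_influence P) hP.memLp_influence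
    hP.integral_influence
  rw [hP.variance_influence] at h
  have hm : ∀ a (n : ℕ), Measurable fun ω : ℕ → Participant 𝒲 ℒ =>
      √(n : ℝ) * (armMean a (fun i : Fin n => ω i) - meanY P a)
        - 2 / pY P * ((√(n : ℝ))⁻¹ * ∑ i ∈ Finset.range n, resid P a (ω i)) := fun a n =>
    ((((measurable_armMean a n).comp (measurable_pi_lambda _ fun i =>
      measurable_pi_apply (i : ℕ))).sub_const _).const_mul _).sub
      (((Finset.measurable_sum _ fun i _ =>
        (measurable_resid P a).comp (measurable_pi_apply i)).const_mul _).const_mul _)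
  -- The normalized influence sum is the difference of the linear parts of the arm means. Adding the
  -- treated remainder and then subtracting the control one recovers the estimation error.
  have h1 := h.add_of_tendstoInMeasure_const (hP.tendstoInMeasure_armMean true)
    fun n => (hm true n).aemeasurable
  have h2 := h1.continuous_comp_prodMk_of_tendstoInMeasure_const
    (g := fun p : ℝ × ℝ => p.1 - p.2) (by fun_prop) (hP.tendstoInMeasure_armMean false)
    fun n => (hm false n).aemeasurable
  unfold HasAVar
  convert h2 using 1
  · ext n ω
    simp only [unadjusted, ate, influence, Pi.add_apply, ← Finset.mul_sum,
      Finset.sum_sub_distrib]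
    ring
  · ext x
    simp

/-- Limits in distribution are unique and a Gaussian law, even degenerate, determines its variance;
so the choice inside `AVar` is harmless. -/
theorem HasAVar.unique {T : Estimator 𝒲 ℒ} {v v' : ℝ≥0} (h : HasAVar P T v)
    (h' : HasAVar P T v') : v = v' := by
  have := tendstoInDistribution_unique _ h h'
  rw [Measure.map_id, Measure.map_id, gaussianReal_ext_iff] at this
  exact this.2

theorem HasAVar.aVar_eq {T : Estimator 𝒲 ℒ} {v : ℝ≥0} (h : HasAVar P T v) : AVar P T = v := by
  have hn : AsympNormal P T := ⟨v, h⟩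
  rw [AVar, dif_pos hn]
  exact hn.choose_spec.unique h

theorem Model.aVar_unadjusted (hP : Model P) :
    (AVar P (unadjusted 𝒲 ℒ) : ℝ) = 2 / pY P * totalVar P := by
  rw [hP.hasAVar_unadjusted.aVar_eq, Real.coe_toNNReal]
  exact mul_nonneg (div_nonneg zero_le_two hP.pY_pos.le) (totalVar_nonneg P)

end Unadjusted

/-! ### The efficiency bound and the ARE in terms of `γ` and the `R²` values. -/

section Efficiency

variable {𝒲 ℒ : Type*} [MeasurableSpace 𝒲] [MeasurableSpace ℒ]
  {P : Measure (Participant 𝒲 ℒ)} [IsProbabilityMeasure P]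

theorem Model.varianceBound_eq (hP : Model P) (h : totalVar P ≠ 0) :
    varianceBound P = (heterogeneity P + 2 / pL P * rsqLW P
      + 2 / pY P * (1 - rsqW P - rsqLW P)) * totalVar P := by
  have ht := hP.totalVar_eq
  rw [varianceBound, heterogeneity, rsqW, rsqLW, ← Finset.mul_sum, ← Finset.mul_sum]
  set a := ∑ a : Bool, Var[regW P a; P]
  set b := ∑ a : Bool, Var[fun x => regLW P a x - regW P a x; armLaw P a]
  set c := ∑ a : Bool, Var[fun x => Y x - regLW P a x; armLaw P a]
  have hc : c = totalVar P - a - b := by linarith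
  rw [hc]
  have h1 := hP.pL_pos.ne'
  have h2 := hP.pY_pos.ne'
  field_simp

/-- The total variance cancels. Working in `ℝ≥0∞` keeps the case of a vanishing denominator, where
the ratio is `∞`. -/
theorem Model.are_unadjusted (hP : Model P) (h : totalVar P ≠ 0) {T : Estimator 𝒲 ℒ}
    (hT : Efficient P T) :
    ARE P T (unadjusted 𝒲 ℒ) = ENNReal.ofReal (2 / pY P) / ENNReal.ofReal
      (heterogeneity P + 2 / pL P * rsqLW P + 2 / pY P * (1 - rsqW P - rsqLW P)) := by
  have hpos : 0 < totalVar P := (totalVar_nonneg P).lt_of_ne' h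
  rw [ARE, ← ENNReal.ofReal_coe_nnreal, ← ENNReal.ofReal_coe_nnreal, hP.aVar_unadjusted,
    hT.attains, hP.varianceBound_eq h, ENNReal.ofReal_mul' hpos.le, ENNReal.ofReal_mul' hpos.le]
  exact ENNReal.mul_div_mul_right _ _ (by simpa using hpos) ENNReal.ofReal_ne_top

theorem Model.heterogeneity_of_rsqW_eq_zero (hP : Model P) (h : rsqW P = 0) :
    heterogeneity P = 0 := by
  refine le_antisymm ?_ (heterogeneity_nonneg P)
  simpa [h] using hP.heterogeneity_le

end Efficiency

end Trial

/-! ### Comparison of the two prognostic scenarios. -/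

theorem mainTheorem6
    {𝒲₁ ℒ₁ 𝒲₂ ℒ₂ : Type*} [MeasurableSpace 𝒲₁] [MeasurableSpace ℒ₁]
    [MeasurableSpace 𝒲₂] [MeasurableSpace ℒ₂]
    (P₁ : Measure (Trial.Participant 𝒲₁ ℒ₁)) (P₂ : Measure (Trial.Participant 𝒲₂ ℒ₂))
    [IsProbabilityMeasure P₁] [IsProbabilityMeasure P₂]
    (hP₁ : Trial.Model P₁) (hP₂ : Trial.Model P₂)
    (p_l p_y q : ℝ)
    (hl₁ : Trial.pL P₁ = p_l) (hl₂ : Trial.pL P₂ = p_l)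
    (hy₁ : Trial.pY P₁ = p_y) (hy₂ : Trial.pY P₂ = p_y)
    (hq_pos : 0 < q) (hq_le : q ≤ 1)
    (hW₁ : Trial.rsqW P₁ = q) (hL₁ : Trial.rsqLW P₁ = 0)
    (hW₂ : Trial.rsqW P₂ = 0) (hL₂ : Trial.rsqLW P₂ = q)
    (T₁ : Trial.Estimator 𝒲₁ ℒ₁) (T₂ : Trial.Estimator 𝒲₂ ℒ₂)
    (hT₁ : Trial.Efficient P₁ T₁) (hT₂ : Trial.Efficient P₂ T₂) :
    -- the unadjusted estimators have asymptotic variances, so both AREs are meaningful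
    Trial.AsympNormal P₁ (Trial.unadjusted 𝒲₁ ℒ₁) ∧
    Trial.AsympNormal P₂ (Trial.unadjusted 𝒲₂ ℒ₂) ∧
    -- comparison
    Trial.ARE P₂ T₂ (Trial.unadjusted 𝒲₂ ℒ₂) ≤ Trial.ARE P₁ T₁ (Trial.unadjusted 𝒲₁ ℒ₁) ∧
    -- equality case
    (Trial.ARE P₁ T₁ (Trial.unadjusted 𝒲₁ ℒ₁) = Trial.ARE P₂ T₂ (Trial.unadjusted 𝒲₂ ℒ₂) ↔
      p_l = 1 ∧ Trial.heterogeneity P₁ = 2 * q) ∧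
    -- `2 q` is the maximum possible heterogeneity, and when it is attained
    Trial.heterogeneity P₁ ≤ 2 * Trial.rsqW P₁ ∧
    Trial.heterogeneity P₂ ≤ 2 * Trial.rsqW P₂ ∧
    (Trial.heterogeneity P₁ = 2 * q ↔
      ∀ᵐ x ∂P₁, Trial.regW P₁ true x - Trial.meanY P₁ true
        = -(Trial.regW P₁ false x - Trial.meanY P₁ false)) ∧
    (Trial.heterogeneity P₁ = 2 * q ↔
      ∀ f : 𝒲₁ → ℝ, Measurable f → MemLp (fun x => f (Trial.W x)) 2 P₁ →
        cov[Trial.Y, fun x => f (Trial.W x); P₁] = 0) := by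
  -- Division by zero gives `0`, so a positive `R²` value excludes zero total variance.
  have hS₁ : Trial.totalVar P₁ ≠ 0 := by
    intro h
    rw [Trial.rsqW, h, div_zero] at hW₁
    exact hq_pos.ne hW₁
  have hS₂ : Trial.totalVar P₂ ≠ 0 := by
    intro h
    rw [Trial.rsqLW, h, div_zero] at hL₂
    exact hq_pos.ne hL₂
  have hl : 0 < p_l := hl₁ ▸ hP₁.pL_pos
  have hl1 : p_l ≤ 1 := hl₁ ▸ measureReal_le_one
  have hy : 0 < 2 / p_y := div_pos two_pos (hy₁ ▸ hP₁.pY_pos)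
  have hA₁ := hP₁.are_unadjusted hS₁ hT₁
  have hA₂ := hP₂.are_unadjusted hS₂ hT₂
  rw [hl₁, hy₁, hW₁, hL₁, mul_zero, add_zero, sub_zero] at hA₁
  rw [hl₂, hy₂, hW₂, hL₂, hP₂.heterogeneity_of_rsqW_eq_zero hW₂, zero_add, sub_zero] at hA₂
  have hγ : Trial.heterogeneity P₁ ≤ 2 * q := hW₁ ▸ hP₁.heterogeneity_le
  have hγ0 : 0 ≤ Trial.heterogeneity P₁ := Trial.heterogeneity_nonneg P₁
  have h2q : 2 * q ≤ 2 / p_l * q := by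
    refine mul_le_mul_of_nonneg_right ?_ hq_pos.le
    rw [le_div_iff₀ hl]
    linarith
  -- Keeps both denominators nonnegative, where `ENNReal.ofReal` is injective.
  have hr : 0 ≤ 2 / p_y * (1 - q) := mul_nonneg hy.le (sub_nonneg.2 hq_le)
  have hiff : Trial.heterogeneity P₁ = 2 * q ↔
      Var[fun x => Trial.regW P₁ true x + Trial.regW P₁ false x; P₁] = 0 := by
    rw [← hW₁]
    exact hP₁.heterogeneity_eq_iff hS₁
  refine ⟨⟨_, hP₁.hasAVar_unadjusted⟩, ⟨_, hP₂.hasAVar_unadjusted⟩, ?_, ?_, hP₁.heterogeneity_le,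
    hP₂.heterogeneity_le, ?_, hiff.trans hP₁.variance_regW_add_eq_zero_iff⟩
  · rw [hA₁, hA₂]
    exact ENNReal.div_le_div_left (ENNReal.ofReal_le_ofReal (by linarith)) _
  · rw [hA₁, hA₂]
    generalize 2 / p_y = c at hy hr
    rw [div_eq_mul_inv (ENNReal.ofReal c), div_eq_mul_inv (ENNReal.ofReal c),
      ENNReal.mul_right_inj (ENNReal.ofReal_pos.2 hy).ne' ENNReal.ofReal_ne_top, inv_inj,
      ENNReal.ofReal_eq_ofReal_iff (by linarith) (by linarith), add_left_inj]
    constructor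
    -- Equal AREs mean that the ends of `γ ≤ 2q ≤ 2q / p_l` coincide, so both inequalities are
    -- equalities.
    · intro h
      have h' : 2 / p_l * q = 2 * q := le_antisymm (h ▸ hγ) h2q
      refine ⟨?_, h.trans h'⟩
      have h2 := mul_right_cancel₀ hq_pos.ne' h'
      rw [div_eq_iff hl.ne'] at h2
      linarith
    · rintro ⟨h1, h⟩
      rw [h, h1, div_one]
  · rw [hiff, Trial.variance_add_eq_zero_iff (hP₁.memLp_regW true) (hP₁.memLp_regW false),
      hP₁.integral_regW, hP₁.integral_regW]
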